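/- **Setting.** Let $A=(a_{pq})$ be a generalized Cartan matrix indexed by a finite set $P$, with $a_{pp}=2$ and off-diagonal entries in $\{0,-1,-2\}$, and let $\Gamma$ be its Dynkin diagram: its vertex set is $P$, distinct $p,q$ are adjacent iff $a_{pq}\neq 0$, and a double edge between $p$ and $q$ has an arrow towards $p$ iff $a_{pq}=-2$. $A$ is simply laced if no entry is $-2$. $A$ is of affine type if $\Gamma$ is connected, $A$ has corank $1$, $Au=0$ for some real vector $u>0$, and $Av\ge 0$ implies $Av=0$ for real $v$. Write $p\,\mathcal C\,q$ if $p,q$ are equal or adjacent. A *labelled heap* over $\Gamma$ is a poset $(E,\le)$ with finite intervals and a map $\varepsilon:E\to P$ such that $\alpha,\beta$ are comparable whenever $\varepsilon(\alpha)\,\mathcal C\,\varepsilon(\beta)$, and $\le$ is the transitive closure of the relation "$\alpha\le\beta$ and $\varepsilon(\alpha)\,\mathcal C\,\varepsilon(\beta)$". It is *fibred* if each $\varepsilon^{-1}(p)$ is nonempty without greatest or least element, and for adjacent $p,p'$ every element labelled $p$ covers or is covered by an element labelled $p'$. A fibred heap is *full* if $\sum_{\gamma\in(\alpha,\beta)}a_{p,\varepsilon(\gamma)}=-2$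 for all $\alpha<\beta$ with $\varepsilon(\alpha)=\varepsilon(\beta)=p$ and $(\alpha,\beta)\cap\varepsilon^{-1}(p)=\emptyset$. *Folding.* Let $A'$ be simply laced of affine type with diagram $\Gamma'$, and let $\mu$ be an automorphism of $\Gamma'$ of order exactly $2$ such that $\mu(p)$ and $p$ are never adjacent. Then $A'$ folds via $\mu$ to the matrix $\overline{A'}$ indexed by the orbits $\bar p=\{p,\mu(p)\}$ with diagonal entries $2$ and, for $\bar p\ne\bar q$, entry $\bar a_{\bar p\bar q}=-2$ if $\mu(p)\ne p$ and $q$ is adjacent to both $p$ and $\mu(p)$; otherwise $\bar a_{\bar p\bar q}=-1$ if $q$ is adjacent to $p$ or to $\mu(p)$; and $\bar a_{\bar p\bar q}=0$ otherwise. $E=(E,\le,\varepsilon)$ is a *simply folded full heap* over $\Gamma$ if either (1) $A$ is of affine type and $E$ is a full heap over $\Gamma$, or (2) $A=\overline{A'}$ for some $A',\mu$ as above, and $\varepsilon=f\circ\varepsilon'$, where $f(p)=\bar p$ and $(E,\le,\varepsilon')$ is a full heap over $\Gamma'$ in which elements $\alpha,\beta$ are comparable whenever $\mu(\varepsilon'(\alpha))\,\mathcal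 C\,\varepsilon'(\beta)$. A *proper ideal* of $E$ is a down-closed set $I$ with $\emptyset\subsetneq I\subsetneq E$ and $\emptyset\subsetneq I\cap\varepsilon^{-1}(p)\subsetneq\varepsilon^{-1}(p)$ for all $p\in P$; $\mathcal B$ is the set (lattice under $\cap,\cup$) of proper ideals. For $i\in P$ and $I\in\mathcal B$ put $S_i(I)=I\setminus\{\alpha\}$ if there is $\alpha\in I$ with $\varepsilon(\alpha)=i$ such that $I\setminus\{\alpha\}$ is an ideal; otherwise $S_i(I)=I\cup\{\alpha\}$ if there is $\alpha\notin I$ with $\varepsilon(\alpha)=i$ such that $I\cup\{\alpha\}$ is an ideal; and $S_i(I)=I$ otherwise (such an $\alpha$ is unique if it exists). The *Weyl group* $W$ of $\Gamma$ has generators $s_i$ ($i\in P$) and relations $s_i^2=1$; $s_is_j=s_js_i$ if $a_{ij}=0$; $s_is_js_i=s_js_is_j$ if $a_{ij}<0$ and $a_{ij}a_{ji}=1$; $s_is_js_is_j=s_js_is_js_i$ if $a_{ij}<0$ and $a_{ij}a_{ji}=2$. The *dual heap* is $E^*=(E,\ge,\varepsilon)$, with the identity anti-isomorphism $*:E\to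 E^*$; let $\mathcal B^*$ be its set of proper ideals and $S_i^*$ its operators. **Proposition.** Let $E$ be a simply folded full heap over $\Gamma$. (i) $W$ acts on $\mathcal B$ with $s_i.I=S_i(I)$ for every generator $s_i$, and this action is transitive (exactly one orbit). (ii) $W$ likewise acts on $\mathcal B^*$ with $s_i.J=S_i^*(J)$, and $I\mapsto *(E\setminus I)$ defines a bijection $\mathcal B\to\mathcal B^*$ that commutes with the actions of $W$; that is, it is an isomorphism of $W$-sets. -/

import Mathlib

universe u v

namespace FullHeap

/-! ### Generalized Cartan matrices and their Dynkin diagrams -/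

/-- Doubly laced generalized Cartan matrices: `a_ii = 2`, off-diagonal entries are
`0`, `-1` or `-2`, and `a_ij = 0` if and only if `a_ji = 0`. -/
structure IsDoublyLacedGCM {P : Type u} (A : Matrix P P ℤ) : Prop where
  diag : ∀ i, A i i = 2
  offDiag : ∀ i j, i ≠ j → A i j = 0 ∨ A i j = -1 ∨ A i j = -2
  zero_iff : ∀ i j, A i j = 0 ↔ A j i = 0

/-- A generalized Cartan matrix is simply laced if it has no entries other than `2, 0, -1`. -/
def IsSimplyLaced {P : Type u} (A : Matrix P P ℤ) : Prop :=
  IsDoublyLacedGCM A ∧ ∀ i j, A i j ≠ -2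

/-- Adjacency of two (distinct) vertices in the Dynkin diagram of `A`. -/
def Adj {P : Type u} (A : Matrix P P ℤ) (p q : P) : Prop := p ≠ q ∧ A p q ≠ 0

/-- The concurrency relation `𝒞`: the vertices are equal or adjacent. -/
def Conc {P : Type u} (A : Matrix P P ℤ) (p q : P) : Prop := p = q ∨ Adj A p q

/-- Doubly laced generalized Cartan matrices of affine type, in the sense of the trichotomy
finite / affine / indefinite: `A` is indecomposable (its Dynkin diagram is connected), has
corank `1`, there is `u > 0` with `A u = 0`, and `A v ≥ 0` implies `A v = 0`. -/
structure IsAffine {P : Type u} [Fintype P] (A : Matrix P P ℤ) : Prop where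
  gcm : IsDoublyLacedGCM A
  connected : ∀ p q, Relation.ReflTransGen (Adj A) p q
  corank : (A.map (Int.cast : ℤ → ℝ)).rank + 1 = Fintype.card P
  exists_pos : ∃ u : P → ℝ, (∀ p, 0 < u p) ∧ (A.map (Int.cast : ℤ → ℝ)).mulVec u = 0
  eq_zero : ∀ v : P → ℝ, (∀ p, 0 ≤ (A.map (Int.cast : ℤ → ℝ)).mulVec v p) →
    (A.map (Int.cast : ℤ → ℝ)).mulVec v = 0

/-! ### Heaps, fibred heaps, full heaps -/

/-- `(E, ≤, ε)` is a (locally finite) labelled heap over the Dynkin diagram of `A`. -/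
structure IsLabelledHeap {P : Type u} {E : Type v} [PartialOrder E]
    (A : Matrix P P ℤ) (ε : E → P) : Prop where
  locallyFinite : ∀ a b : E, (Set.Icc a b).Finite
  comparable : ∀ a b : E, Conc A (ε a) (ε b) → a ≤ b ∨ b ≤ a
  le_iff : ∀ a b : E, a ≤ b ↔ Relation.TransGen (fun x y => x ≤ y ∧ Conc A (ε x) (ε y)) a b

/-- Fibred heaps: every fibre `ε⁻¹(p)` is nonempty and has neither a greatest nor a least
element (so it is a chain isomorphic to `ℤ`), and every element labelled `p` is in a covering
relation with an element labelled `q`, for each `q` adjacent to `p`. -/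
structure IsFibred {P : Type u} {E : Type v} [PartialOrder E]
    (A : Matrix P P ℤ) (ε : E → P) : Prop where
  heap : IsLabelledHeap A ε
  nonempty : ∀ p, ∃ a, ε a = p
  unbounded_above : ∀ a, ∃ b, ε b = ε a ∧ a < b
  unbounded_below : ∀ a, ∃ b, ε b = ε a ∧ b < a
  covers : ∀ a q, Adj A (ε a) q → ∃ b, ε b = q ∧ (b ⋖ a ∨ a ⋖ b)

/-- Full heaps: in every open interval between two consecutive elements `a < b` of a fibre
`ε⁻¹(p)`, the sum of the entries `a_{p, ε(c)}` is `-2`. (Open intervals are finite.) -/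
structure IsFull {P : Type u} {E : Type v} [PartialOrder E]
    (A : Matrix P P ℤ) (ε : E → P) : Prop where
  fibred : IsFibred A ε
  sum_eq : ∀ a b : E, a < b → ε a = ε b → (∀ c ∈ Set.Ioo a b, ε c ≠ ε a) →
    ∑ᶠ c ∈ Set.Ioo a b, A (ε a) (ε c) = -2

/-! ### Folding -/

open Classical in
/-- The entry, in row `p̄` and column `q̄`, of the matrix obtained from the simply laced `A` by
folding via the involution `μ`. Distinct orbits are joined when some of their members are
adjacent; if `q` is adjacent both to `p` and to `μ p ≠ p`, then they are joined by a double edge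
with an arrow pointing towards `p̄`, that is, the entry is `-2`. -/
noncomputable def foldedEntry {P : Type u} (A : Matrix P P ℤ) (μ : Equiv.Perm P) (p q : P) : ℤ :=
  if q = p ∨ q = μ p then 2
  else if μ p ≠ p ∧ Adj A p q ∧ Adj A (μ p) q then -2
  else if Adj A p q ∨ Adj A (μ p) q then -1
  else 0

/-- The simply laced affine matrix `A` folds to `B` via the diagram automorphism `μ` of order
two, where `f` sends a vertex to its `μ`-orbit (the vertices of the diagram of `B` are, up to
names, the `μ`-orbits). -/
structure IsFolding {P Q : Type u} [Fintype P] (A : Matrix P P ℤ) (μ : Equiv.Perm P)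
    (B : Matrix Q Q ℤ) (f : P → Q) : Prop where
  affine : IsAffine A
  simplyLaced : IsSimplyLaced A
  automorphism : ∀ p q, A (μ p) (μ q) = A p q
  ne_one : μ ≠ 1
  involutive : ∀ p, μ (μ p) = p
  not_adj : ∀ p, ¬ Adj A (μ p) p
  surjective : Function.Surjective f
  fibres : ∀ p q, f p = f q ↔ q = p ∨ q = μ p
  entries : ∀ p q, B (f p) (f q) = foldedEntry A μ p q

/-- Simply folded full heaps over the Dynkin diagram of `A`: either `A` is of affine type and
`(E, ≤, ε)` is a full heap over it; or `A` arises by folding a simply laced affine `A'` via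
some `μ`, and `(E, ≤, ε) = (E, ≤, f ∘ ε')` for a full heap `(E, ≤, ε')` over `A'` such that
elements labelled `p` and `q` are comparable whenever `μ p` and `q` are equal or adjacent. -/
def IsSimplyFoldedFull {P : Type u} {E : Type v} [Fintype P] [PartialOrder E]
    (A : Matrix P P ℤ) (ε : E → P) : Prop :=
  (IsAffine A ∧ IsFull A ε) ∨
  ∃ (P' : Type u) (_ : Fintype P') (A' : Matrix P' P' ℤ) (μ : Equiv.Perm P') (f : P' → P)
    (ε' : E → P'),
    IsFolding A' μ A f ∧ IsFull A' ε' ∧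
    (∀ a b : E, Conc A' (μ (ε' a)) (ε' b) → a ≤ b ∨ b ≤ a) ∧
    ε = f ∘ ε'

/-! ### The Weyl group -/

/-- The defining relators of the Weyl group; a relation `x = y` is recorded as `x * y⁻¹`. -/
inductive WeylRel {P : Type u} (A : Matrix P P ℤ) : FreeGroup P → Prop
  | sq (i : P) : WeylRel A (FreeGroup.of i * FreeGroup.of i)
  | comm (i j : P) (h : A i j = 0) :
      WeylRel A ((FreeGroup.of i * FreeGroup.of j) * (FreeGroup.of j * FreeGroup.of i)⁻¹)
  | braid3 (i j : P) (h : A i j < 0) (h' : A i j * A j i = 1) :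
      WeylRel A ((FreeGroup.of i * FreeGroup.of j * FreeGroup.of i) *
        (FreeGroup.of j * FreeGroup.of i * FreeGroup.of j)⁻¹)
  | braid4 (i j : P) (h : A i j < 0) (h' : A i j * A j i = 2) :
      WeylRel A ((FreeGroup.of i * FreeGroup.of j * FreeGroup.of i * FreeGroup.of j) *
        (FreeGroup.of j * FreeGroup.of i * FreeGroup.of j * FreeGroup.of i)⁻¹)

/-- The Weyl group of (the Dynkin diagram of) `A`, by generators and relations. -/
abbrev WeylGroup {P : Type u} (A : Matrix P P ℤ) : Type u :=
  PresentedGroup {r : FreeGroup P | WeylRel A r}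

/-- The generator `s_i` of the Weyl group. -/
def simpleReflection {P : Type u} (A : Matrix P P ℤ) (i : P) : WeylGroup A :=
  PresentedGroup.of i

/-! ### Proper ideals and the operators `S_i` -/

/-- Proper ideals: lower sets that meet every fibre of the labelling in a nonempty proper subset
of that fibre. -/
structure IsProperIdeal {P : Type u} {E : Type v} [PartialOrder E]
    (ε : E → P) (I : Set E) : Prop where
  isLowerSet : IsLowerSet I
  nonempty : I.Nonempty
  ne_univ : I ≠ Set.univ
  exists_mem : ∀ p, ∃ a, a ∈ I ∧ ε a = p
  exists_notMem : ∀ p, ∃ a, a ∉ I ∧ ε a = p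

/-- The set `ℬ` of proper ideals. -/
abbrev ProperIdeal {P : Type u} {E : Type v} [PartialOrder E] (ε : E → P) : Type v :=
  {I : Set E // IsProperIdeal ε I}

/-- `{a} ≺ I`: the element `a` of `I` can be removed. -/
def Removable {E : Type v} [PartialOrder E] (a : E) (I : Set E) : Prop :=
  a ∈ I ∧ IsLowerSet (I \ {a})

/-- `{a} ≻ I`: the element `a` outside `I` can be added. -/
def Addable {E : Type v} [PartialOrder E] (a : E) (I : Set E) : Prop :=
  a ∉ I ∧ IsLowerSet (I ∪ {a})

open Classical in
/-- The operator `S_i` on ideals: remove the element labelled `i` that can be removed, if there is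
one; otherwise add the element labelled `i` that can be added, if there is one; otherwise do
nothing. (In a simply folded full heap these elements are unique.) -/
noncomputable def opS {P : Type u} {E : Type v} [PartialOrder E]
    (ε : E → P) (i : P) (I : Set E) : Set E :=
  if h : ∃ a, ε a = i ∧ Removable a I then I \ {h.choose}
  else if h : ∃ a, ε a = i ∧ Addable a I then I ∪ {h.choose}
  else I

/-- The labelling of the dual heap `E* = (E, ≥, ε)`; the map `* : E → E*` is
`OrderDual.toDual`. -/
def dualLabel {P : Type u} {E : Type v} (ε : E → P) : Eᵒᵈ → P := fun a => ε (OrderDual.ofDual a)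

end FullHeap

/-! Everything rests on one numerical rule: over the open interval between consecutive elements of
the fibre of `p`, the entries of row `p` add up to `-2`. It is part of the definition of a full heap
and it survives folding (`IsFolding.isFullOver`), so both kinds of simply folded full heap are
treated at once as `IsFullOver`.

Let `I` be a proper ideal, and let `a ∈ I`, `b ∉ I` be the consecutive elements of the fibre of `p`
between which `I` stops. Splitting the interval into its parts inside and outside `I` gives
nonpositive integers `s + t = -2`. The element `a` is removable iff `s = 0`, and `b` is addable iff
`t = 0`; so never both, and the weight coordinate `wt` equals `1 + s` (`IsCut.wt_eq`). Since adding
an element `c` changes the `q`-th weight by `A q (ε c)` (`IsFullOver.wt_union`), `S_i` acts on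
weights as a simple reflection, and it lowers the number of elements labelled `i` by the `i`-th
weight (`IsFullOver.wt_opS`, `IsFullOver.height_opS`). These numbers, taken relative to a base
ideal, determine the ideal, so the Weyl group relations become polynomial identities in weights and
matrix entries.

For transitivity, two proper ideals differ by finitely many elements because `P` is finite, and each
descends to their intersection by removing maximal elements of the difference. Complementation
exchanges removable and addable elements, hence intertwines the operators of `E` and of its dual. -/

namespace FullHeap

open Set

/-! ### Finite sums of nonpositive integers -/

section Sums

variable {E : Type v} {s t : Set E} {g : E → ℤ}

lemma finsum_mem_anti_of_nonpos (ht : t.Finite) (hst : s ⊆ t) (hg : ∀ c ∈ t, g c ≤ 0) :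
    ∑ᶠ c ∈ t, g c ≤ ∑ᶠ c ∈ s, g c := by
  have h := finsum_mem_inter_add_sdiff (f := g) s ht
  rw [inter_eq_self_of_subset_right hst] at h
  have h2 : ∑ᶠ c ∈ t \ s, g c ≤ 0 := by
    rw [finsum_mem_eq_finite_toFinset_sum g (ht.subset sdiff_subset)]
    refine Finset.sum_nonpos fun c hc => hg c ?_
    simp only [Finite.mem_toFinset] at hc
    exact hc.1
  linarith

lemma finsum_mem_nonpos (ht : t.Finite) (hg : ∀ c ∈ t, g c ≤ 0) : ∑ᶠ c ∈ t, g c ≤ 0 := by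
  simpa using finsum_mem_anti_of_nonpos ht (empty_subset t) hg

lemma finsum_mem_le_of_mem (ht : t.Finite) (hg : ∀ c ∈ t, g c ≤ 0) {x : E} (hx : x ∈ t) :
    ∑ᶠ c ∈ t, g c ≤ g x := by
  simpa using finsum_mem_anti_of_nonpos ht (singleton_subset_iff.2 hx) hg

end Sums

/-! ### Row sums over intervals of a labelled heap -/

section Heap

variable {P : Type u} {E : Type v} [PartialOrder E] {A : Matrix P P ℤ} {ε : E → P}

lemma IsDoublyLacedGCM.nonpos (hA : IsDoublyLacedGCM A) {i j : P} (h : i ≠ j) : A i j ≤ 0 := by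
  rcases hA.offDiag i j h with h | h | h <;> omega

lemma IsDoublyLacedGCM.adj_symm (hA : IsDoublyLacedGCM A) {i j : P} (h : Adj A i j) :
    Adj A j i :=
  ⟨h.1.symm, fun h' => h.2 ((hA.zero_iff j i).1 h')⟩

/-- Above `x`, on the way to a larger element, there is an element whose label is concurrent to
that of `x`. -/
lemma IsLabelledHeap.exists_conc_above (h : IsLabelledHeap A ε) {x y : E} (hxy : x < y) :
    ∃ c, x < c ∧ c ≤ y ∧ Conc A (ε x) (ε c) := by
  have key := (h.le_iff x y).1 hxy.le
  revert hxy
  induction key using Relation.TransGen.head_induction_on with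
  | single h1 => exact fun hxy => ⟨y, hxy, le_rfl, h1.2⟩
  | @head a c h1 h2 ih =>
    intro hxy
    rcases h1.1.eq_or_lt with e | hlt
    · subst e; exact ih hxy
    · exact ⟨c, hlt, (h.le_iff c y).2 h2, h1.2⟩

lemma IsLabelledHeap.exists_conc_below (h : IsLabelledHeap A ε) {x y : E} (hxy : x < y) :
    ∃ c, x ≤ c ∧ c < y ∧ Conc A (ε c) (ε y) := by
  have key := (h.le_iff x y).1 hxy.le
  revert hxy
  induction key with
  | single h1 => exact fun hxy => ⟨x, le_rfl, hxy, h1.2⟩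
  | @tail c b h2 h1 ih =>
    intro hxy
    rcases h1.1.eq_or_lt with e | hlt
    · subst e; exact ih hxy
    · exact ⟨c, (h.le_iff x c).2 h2, hlt, h1.2⟩

/-- The common features of full heaps and of folded full heaps: a labelled heap over a connected
diagram with unbounded fibres, in which the entries over the open interval between two consecutive
elements of a fibre add up to `-2`. -/
structure IsFullOver (A : Matrix P P ℤ) (ε : E → P) : Prop where
  gcm : IsDoublyLacedGCM A
  connected : ∀ p q, Relation.ReflTransGen (Adj A) p q
  heap : IsLabelledHeap A ε
  nonempty : Nonempty P
  exists_label : ∀ p, ∃ a, ε a = p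
  unbounded_above : ∀ a, ∃ b, ε b = ε a ∧ a < b
  unbounded_below : ∀ a, ∃ b, ε b = ε a ∧ b < a
  sum_eq : ∀ a b : E, a < b → ε a = ε b → (∀ c ∈ Ioo a b, ε c ≠ ε a) →
    ∑ᶠ c ∈ Ioo a b, A (ε a) (ε c) = -2

lemma IsFull.isFullOver [Fintype P] (hA : IsAffine A) (h : IsFull A ε) : IsFullOver A ε where
  gcm := hA.gcm
  connected := hA.connected
  heap := h.fibred.heap
  nonempty := by
    have : 0 < Fintype.card P := by have := hA.corank; omega
    exact Fintype.card_pos_iff.1 this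
  exists_label := h.fibred.nonempty
  unbounded_above := h.fibred.unbounded_above
  unbounded_below := h.fibred.unbounded_below
  sum_eq := h.sum_eq

/-- The double edge of a folding is the case where both summands are `-1`. Additivity lets a row sum
of the folded matrix split into two row sums of the original one. -/
lemma foldedEntry_eq_add (hA : IsSimplyLaced A) {μ : Equiv.Perm P} {p q : P} (h1 : q ≠ p)
    (h2 : q ≠ μ p) (h3 : μ p ≠ p) : foldedEntry A μ p q = A p q + A (μ p) q := by
  have ha := hA.1.offDiag p q h1.symm
  have hb := hA.1.offDiag (μ p) q h2.symm
  have ha' := hA.2 p q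
  have hb' := hA.2 (μ p) q
  unfold foldedEntry Adj
  rw [if_neg (by tauto)]
  simp only [h1.symm, h2.symm, h3, ne_eq, not_false_eq_true, true_and]
  rcases ha with ha | ha | ha <;> rcases hb with hb | hb | hb <;> simp_all

lemma foldedEntry_eq_of_fixed (hA : IsSimplyLaced A) {μ : Equiv.Perm P} {p q : P} (h1 : q ≠ p)
    (h3 : μ p = p) : foldedEntry A μ p q = A p q := by
  have ha := hA.1.offDiag p q h1.symm
  have ha' := hA.2 p q
  unfold foldedEntry Adj
  rw [if_neg (by rw [h3]; tauto), if_neg (by tauto)]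
  rcases ha with ha | ha | ha <;> simp_all [h1.symm]

/-- Between `x < y` with labels that are neither equal nor adjacent there is an element whose
label is adjacent to that of `x`, provided no element in between shares the label of `x`. -/
lemma IsLabelledHeap.exists_adj_above (h : IsLabelledHeap A ε) {x y : E} (hxy : x < y)
    (hc : ¬ Conc A (ε x) (ε y)) (hno : ∀ c ∈ Ioo x y, ε c ≠ ε x) :
    ∃ c ∈ Ioo x y, A (ε x) (ε c) ≠ 0 := by
  obtain ⟨c, h1, h2, h3⟩ := h.exists_conc_above hxy
  have hcy : c < y := lt_of_le_of_ne h2 (by rintro rfl; exact hc h3)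
  rcases h3 with h3 | h3
  · exact absurd h3.symm (hno c ⟨h1, hcy⟩)
  · exact ⟨c, ⟨h1, hcy⟩, h3.2⟩

lemma IsLabelledHeap.exists_adj_below (hA : IsDoublyLacedGCM A) (h : IsLabelledHeap A ε)
    {x y : E} (hxy : x < y)
    (hc : ¬ Conc A (ε x) (ε y)) (hno : ∀ c ∈ Ioo x y, ε c ≠ ε y) :
    ∃ c ∈ Ioo x y, A (ε y) (ε c) ≠ 0 := by
  obtain ⟨c, h1, h2, h3⟩ := h.exists_conc_below hxy
  have hcy : x < c := lt_of_le_of_ne h1 (by rintro rfl; exact hc h3)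
  rcases h3 with h3 | h3
  · exact absurd h3 (hno c ⟨hcy, h2⟩)
  · exact ⟨c, ⟨hcy, h2⟩, (hA.adj_symm h3).2⟩

/-- If `x` is comparable to all elements with a given label, then there is a last element with
this label below `x`. -/
lemma IsFullOver.exists_last_below (h : IsFullOver A ε) {x y : E}
    (hc : ∀ b, ε b = ε y → b ≤ x ∨ x ≤ b) :
    ∃ a, ε a = ε y ∧ a < x ∧ ∀ c ∈ Ioo a x, ε c ≠ ε y := by
  have h1 : ∃ a, ε a = ε y ∧ a < x := by
    -- Otherwise the whole fibre lies above `x`. Its part in `[x, y]` is finite and has a minimal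
    -- element, yet the fibre has no least element.
    by_contra! hno
    have hge : ∀ b, ε b = ε y → x ≤ b := by
      intro b hb
      rcases hc b hb with hbx | hbx
      · exact (hbx.eq_or_lt.resolve_right (hno b hb)).ge
      · exact hbx
    have hfin : ({b | ε b = ε y} ∩ Icc x y).Finite :=
      (h.heap.locallyFinite x y).subset inter_subset_right
    obtain ⟨m, hm⟩ := hfin.exists_minimal ⟨y, rfl, hge y rfl, le_rfl⟩
    obtain ⟨b, hb, hlt⟩ := h.unbounded_below m
    have hbm : ε b = ε y := hb.trans hm.1.1
    exact absurd (hm.2 ⟨hbm, hge b hbm, hlt.le.trans hm.1.2.2⟩ hlt.le) hlt.not_ge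
  obtain ⟨a, ha, hax⟩ := h1
  have hfin : ({b | ε b = ε y} ∩ Ico a x).Finite :=
    (h.heap.locallyFinite a x).subset (inter_subset_right.trans Ico_subset_Icc_self)
  obtain ⟨m, hm⟩ := hfin.exists_maximal ⟨a, ha, le_rfl, hax⟩
  exact ⟨m, hm.1.1, hm.1.2.2, fun c hcm hcy =>
    (hm.2 ⟨hcy, hm.1.2.1.trans hcm.1.le, hcm.2⟩ hcm.1.le).not_gt hcm.1⟩

lemma IsFullOver.exists_first_above (h : IsFullOver A ε) {x y : E}
    (hc : ∀ b, ε b = ε y → b ≤ x ∨ x ≤ b) :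
    ∃ a, ε a = ε y ∧ x < a ∧ ∀ c ∈ Ioo x a, ε c ≠ ε y := by
  have h1 : ∃ a, ε a = ε y ∧ x < a := by
    by_contra! hno
    have hge : ∀ b, ε b = ε y → b ≤ x := by
      intro b hb
      rcases hc b hb with hbx | hbx
      · exact hbx
      · exact (hbx.eq_or_lt.resolve_right (hno b hb)).ge
    have hfin : ({b | ε b = ε y} ∩ Icc y x).Finite :=
      (h.heap.locallyFinite y x).subset inter_subset_right
    obtain ⟨m, hm⟩ := hfin.exists_maximal ⟨y, rfl, le_rfl, hge y rfl⟩
    obtain ⟨b, hb, hlt⟩ := h.unbounded_above m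
    have hbm : ε b = ε y := hb.trans hm.1.1
    exact absurd (hm.2 ⟨hbm, hm.1.2.1.trans hlt.le, hge b hbm⟩ hlt.le) hlt.not_ge
  obtain ⟨a, ha, hax⟩ := h1
  have hfin : ({b | ε b = ε y} ∩ Ioc x a).Finite :=
    (h.heap.locallyFinite x a).subset (inter_subset_right.trans Ioc_subset_Icc_self)
  obtain ⟨m, hm⟩ := hfin.exists_minimal ⟨a, ha, hax, le_rfl⟩
  exact ⟨m, hm.1.1, hm.1.2.1, fun c hcm hcy =>
    (hm.2 ⟨hcy, hcm.1, hcm.2.le.trans hm.1.2.2⟩ hcm.2.le).not_gt hcm.2⟩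

/-- Only an inequality, because the elements of `(x, z)` outside the two pieces, such as `y` itself,
contribute nonpositive terms. -/
lemma finsum_mem_Ioo_le_add {x y z : E} {g : E → ℤ} (hfin : (Icc x z).Finite) (hxy : x < y)
    (hyz : y < z) (hg : ∀ c ∈ Ioo x z, g c ≤ 0) :
    ∑ᶠ c ∈ Ioo x z, g c ≤ ∑ᶠ c ∈ Ioo x y, g c + ∑ᶠ c ∈ Ioo y z, g c := by
  have hfin' := hfin.subset Ioo_subset_Icc_self
  have s1 : Ioo x y ⊆ Ioo x z := Ioo_subset_Ioo_right hyz.le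
  have s2 : Ioo y z ⊆ Ioo x z := Ioo_subset_Ioo_left hxy.le
  rw [← finsum_mem_union _ (hfin'.subset s1) (hfin'.subset s2)]
  · exact finsum_mem_anti_of_nonpos hfin' (union_subset s1 s2) hg
  · exact disjoint_left.2 fun c h1 h2 => (h1.2.trans h2.1).false

/-- Between consecutive elements of the fibre of `p` that have no element labelled `p'` in between,
where `p'` is different from `p` and not adjacent to it, there is no element with label adjacent
to `p'`. -/
lemma IsFullOver.sum_eq_zero (h : IsFullOver A ε) {x y z : E} (hxy : x < y) (hε : ε x = ε y)
    (hc : ¬ Conc A (ε x) (ε z)) (hcmp : ∀ a b, ε a = ε z → ε b = ε x → a ≤ b ∨ b ≤ a)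
    (hno : ∀ c ∈ Ioo x y, ε c ≠ ε z) :
    ∑ᶠ c ∈ Ioo x y, A (ε z) (ε c) = 0 := by
  have hc' : ¬ Conc A (ε z) (ε x) := fun hh => hc (hh.imp Eq.symm h.gcm.adj_symm)
  obtain ⟨d, hd, hdx, hd'⟩ := h.exists_last_below (x := x) (y := z) fun b hb => hcmp b x hb rfl
  obtain ⟨e, he, hye, he'⟩ := h.exists_first_above (x := y) (y := z)
    fun b hb => hcmp b y hb hε.symm
  have hcons : ∀ c ∈ Ioo d e, ε c ≠ ε z := by
    intro c hcde hcz
    have hcx : c ≠ x := by rintro rfl; exact hc (Or.inl hcz)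
    have hcy : c ≠ y := by rintro rfl; exact hc (Or.inl (hε.trans hcz))
    rcases hcmp c x hcz rfl with h1 | h1
    · exact hd' c ⟨hcde.1, lt_of_le_of_ne h1 hcx⟩ hcz
    rcases hcmp c y hcz hε.symm with h2 | h2
    · exact hno c ⟨lt_of_le_of_ne h1 hcx.symm, lt_of_le_of_ne h2 hcy⟩ hcz
    · exact he' c ⟨lt_of_le_of_ne h2 hcy.symm, hcde.2⟩ hcz
  have hneg : ∀ c ∈ Ioo d e, A (ε z) (ε c) ≤ 0 := fun c hcde => h.gcm.nonpos (hcons c hcde).symm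
  have htot := h.sum_eq d e (hdx.trans (hxy.trans hye)) (hd.trans he.symm)
    (fun c hcde => by rw [hd]; exact hcons c hcde)
  rw [hd] at htot
  have hF := h.heap.locallyFinite
  have hfin : ∀ a b : E, (Ioo a b).Finite := fun a b => (hF a b).subset Ioo_subset_Icc_self
  -- The total over `(d, e)` is `-2`. Each of `(d, x)` and `(y, e)` contains an element with label
  -- adjacent to that of `z`, so each contributes at most `-1`, and nothing is left for `(x, y)`.
  have i1 := finsum_mem_Ioo_le_add (hF d e) hdx (hxy.trans hye) hneg
  have i2 := finsum_mem_Ioo_le_add (hF x e) hxy hye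
    (fun c hcm => hneg c ⟨hdx.trans hcm.1, hcm.2⟩)
  obtain ⟨u, hu, hu'⟩ := h.heap.exists_adj_above hdx (by rwa [hd])
    (fun c hcm => by rw [hd]; exact hd' c hcm)
  obtain ⟨w, hw, hw'⟩ := h.heap.exists_adj_below h.gcm hye (by rwa [he, ← hε])
    (fun c hcm => by rw [he]; exact he' c hcm)
  rw [hd] at hu'
  rw [he] at hw'
  have j1 := finsum_mem_le_of_mem (hfin d x)
    (fun c hcm => hneg c ⟨hcm.1, hcm.2.trans (hxy.trans hye)⟩) hu
  have j2 := finsum_mem_le_of_mem (hfin y e)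
    (fun c hcm => hneg c ⟨(hdx.trans hxy).trans hcm.1, hcm.2⟩) hw
  have j3 := finsum_mem_nonpos (hfin x y)
    (fun c hcm => hneg c ⟨hdx.trans hcm.1, hcm.2.trans hye⟩)
  have k1 := hneg u ⟨hu.1, hu.2.trans (hxy.trans hye)⟩
  have k2 := hneg w ⟨(hdx.trans hxy).trans hw.1, hw.2⟩
  omega

/-- If `d` is the last element below `x` with the label of `y`, the total `-2` over `(d, y)` is
shared by `(d, x)` and `(x, y)`. Each takes at most `-1`, since a chain between non-concurrent
labels must pass through a neighbour. -/
lemma IsFullOver.sum_right_eq_neg_one (h : IsFullOver A ε) {x y : E} (hxy : x < y)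
    (hc : ¬ Conc A (ε x) (ε y)) (hcmp : ∀ a b, ε a = ε y → ε b = ε x → a ≤ b ∨ b ≤ a)
    (hno : ∀ c ∈ Ioo x y, ε c ≠ ε y) :
    ∑ᶠ c ∈ Ioo x y, A (ε y) (ε c) = -1 := by
  have hc' : ¬ Conc A (ε y) (ε x) := fun hh => hc (hh.imp Eq.symm h.gcm.adj_symm)
  obtain ⟨d, hd, hdx, hd'⟩ := h.exists_last_below (x := x) (y := y) fun b hb => hcmp b x hb rfl
  have hcons : ∀ c ∈ Ioo d y, ε c ≠ ε y := by
    intro c hcde hcz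
    have hcx : c ≠ x := by rintro rfl; exact hc (Or.inl hcz)
    rcases hcmp c x hcz rfl with h1 | h1
    · exact hd' c ⟨hcde.1, lt_of_le_of_ne h1 hcx⟩ hcz
    · exact hno c ⟨lt_of_le_of_ne h1 hcx.symm, hcde.2⟩ hcz
  have hneg : ∀ c ∈ Ioo d y, A (ε y) (ε c) ≤ 0 := fun c hcde => h.gcm.nonpos (hcons c hcde).symm
  have htot := h.sum_eq d y (hdx.trans hxy) hd (fun c hcde => by rw [hd]; exact hcons c hcde)
  rw [hd] at htot
  have hF := h.heap.locallyFinite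
  have hfin : ∀ a b : E, (Ioo a b).Finite := fun a b => (hF a b).subset Ioo_subset_Icc_self
  have i1 := finsum_mem_Ioo_le_add (hF d y) hdx hxy hneg
  obtain ⟨u, hu, hu'⟩ := h.heap.exists_adj_above hdx (by rwa [hd])
    (fun c hcm => by rw [hd]; exact hd' c hcm)
  obtain ⟨w, hw, hw'⟩ := h.heap.exists_adj_below h.gcm hxy hc hno
  rw [hd] at hu'
  have j1 := finsum_mem_le_of_mem (hfin d x)
    (fun c hcm => hneg c ⟨hcm.1, hcm.2.trans hxy⟩) hu
  have j2 := finsum_mem_le_of_mem (hfin x y)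
    (fun c hcm => hneg c ⟨hdx.trans hcm.1, hcm.2⟩) hw
  have k1 := hneg u ⟨hu.1, hu.2.trans hxy⟩
  have k2 := hneg w ⟨hdx.trans hw.1, hw.2⟩
  omega

lemma IsFullOver.sum_left_eq_neg_one (h : IsFullOver A ε) {x y : E} (hxy : x < y)
    (hc : ¬ Conc A (ε x) (ε y)) (hcmp : ∀ a b, ε a = ε x → ε b = ε y → a ≤ b ∨ b ≤ a)
    (hno : ∀ c ∈ Ioo x y, ε c ≠ ε x) :
    ∑ᶠ c ∈ Ioo x y, A (ε x) (ε c) = -1 := by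
  have hc' : ¬ Conc A (ε y) (ε x) := fun hh => hc (hh.imp Eq.symm h.gcm.adj_symm)
  obtain ⟨e, he, hye, he'⟩ := h.exists_first_above (x := y) (y := x) fun b hb => hcmp b y hb rfl
  have hcons : ∀ c ∈ Ioo x e, ε c ≠ ε x := by
    intro c hcde hcz
    have hcy : c ≠ y := by rintro rfl; exact hc (Or.inl hcz.symm)
    rcases hcmp c y hcz rfl with h1 | h1
    · exact hno c ⟨hcde.1, lt_of_le_of_ne h1 hcy⟩ hcz
    · exact he' c ⟨lt_of_le_of_ne h1 hcy.symm, hcde.2⟩ hcz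
  have hneg : ∀ c ∈ Ioo x e, A (ε x) (ε c) ≤ 0 := fun c hcde => h.gcm.nonpos (hcons c hcde).symm
  have htot := h.sum_eq x e (hxy.trans hye) he.symm hcons
  have hF := h.heap.locallyFinite
  have hfin : ∀ a b : E, (Ioo a b).Finite := fun a b => (hF a b).subset Ioo_subset_Icc_self
  have i1 := finsum_mem_Ioo_le_add (hF x e) hxy hye hneg
  obtain ⟨u, hu, hu'⟩ := h.heap.exists_adj_above hxy hc hno
  obtain ⟨w, hw, hw'⟩ := h.heap.exists_adj_below h.gcm hye (by rwa [he])
    (fun c hcm => by rw [he]; exact he' c hcm)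
  rw [he] at hw'
  have j1 := finsum_mem_le_of_mem (hfin x y)
    (fun c hcm => hneg c ⟨hcm.1, hcm.2.trans hye⟩) hu
  have j2 := finsum_mem_le_of_mem (hfin y e)
    (fun c hcm => hneg c ⟨hxy.trans hcm.1, hcm.2⟩) hw
  have k1 := hneg u ⟨hu.1, hu.2.trans hye⟩
  have k2 := hneg w ⟨hxy.trans hw.1, hw.2⟩
  omega

end Heap

/-! ### Folding preserves the row-sum condition -/

section Folding

variable {P Q : Type u} {E : Type v} [Fintype P] [PartialOrder E] {A : Matrix P P ℤ}
  {B : Matrix Q Q ℤ} {μ : Equiv.Perm P} {f : P → Q} {ε : E → P}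

lemma IsFolding.adj (hf : IsFolding A μ B f) {p q : P} (h : Adj A p q) : Adj B (f p) (f q) := by
  have h1 : q ≠ μ p := by
    rintro rfl; exact hf.not_adj p (hf.affine.gcm.adj_symm h)
  refine ⟨fun he => ?_, ?_⟩
  · rcases (hf.fibres p q).1 he with e | e
    exacts [h.1 e.symm, h1 e]
  · rw [hf.entries]
    have h2 := h.1.symm
    unfold foldedEntry
    split_ifs <;> simp_all

lemma IsFolding.conc (hf : IsFolding A μ B f) {p q : P} (h : Conc A p q) :
    Conc B (f p) (f q) :=
  h.imp (congrArg f) hf.adj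

lemma IsFolding.conc_or (hf : IsFolding A μ B f) {p q : P} (h : Conc B (f p) (f q)) :
    Conc A p q ∨ Conc A (μ p) q := by
  rcases h with h | h
  · rcases (hf.fibres p q).1 h with e | e
    exacts [Or.inl (Or.inl e.symm), Or.inr (Or.inl e.symm)]
  · have h2 := h.2
    rw [hf.entries] at h2
    unfold foldedEntry at h2
    unfold Conc
    split_ifs at h2 <;> grind

/-- A full heap over `A` satisfying the comparability condition of a folding becomes, after
folding, full over the folded matrix. -/
lemma IsFolding.isFullOver (hf : IsFolding A μ B f) (hB : IsDoublyLacedGCM B) (hε : IsFull A ε)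
    (hcmp : ∀ a b : E, Conc A (μ (ε a)) (ε b) → a ≤ b ∨ b ≤ a) : IsFullOver B (f ∘ ε) := by
  have h := hε.isFullOver hf.affine
  refine ⟨hB, ?_, ⟨h.heap.locallyFinite, ?_, ?_⟩, h.nonempty.map f, ?_, ?_, ?_, ?_⟩
  · intro p q
    obtain ⟨p, rfl⟩ := hf.surjective p
    obtain ⟨q, rfl⟩ := hf.surjective q
    exact (h.connected p q).lift f fun _ _ => hf.adj
  · intro a b hab
    rcases hf.conc_or hab with h1 | h1
    exacts [h.heap.comparable a b h1, hcmp a b h1]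
  · refine fun a b => ⟨fun hab => ?_, fun hab => ?_⟩
    · exact ((h.heap.le_iff a b).1 hab).lift id fun x y hxy => ⟨hxy.1, hf.conc hxy.2⟩
    · induction hab with
      | single h1 => exact h1.1
      | tail _ h1 ih => exact ih.trans h1.1
  · intro p
    obtain ⟨p, rfl⟩ := hf.surjective p
    exact (hε.fibred.nonempty p).imp fun _ => congrArg f
  · intro a
    obtain ⟨b, hb, hab⟩ := h.unbounded_above a
    exact ⟨b, congrArg f hb, hab⟩
  · intro a
    obtain ⟨b, hb, hab⟩ := h.unbounded_below a
    exact ⟨b, congrArg f hb, hab⟩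
  · intro x y hxy hxyε hno
    simp only [Function.comp_apply] at hxyε hno ⊢
    have hno' : ∀ c ∈ Ioo x y, ε c ≠ ε x ∧ ε c ≠ μ (ε x) := fun c hc => by
      have := fun e => hno c hc ((hf.fibres (ε x) (ε c)).2 e).symm
      tauto
    have hfin : (Ioo x y).Finite := (h.heap.locallyFinite x y).subset Ioo_subset_Icc_self
    -- A label fixed by `μ` is alone in its orbit, and the folded row agrees with its own row away
    -- from the diagonal.
    by_cases hfix : μ (ε x) = ε x
    · have hxy' : ε x = ε y := by
        rcases (hf.fibres _ _).1 hxyε with e | e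
        exacts [e.symm, (e.trans hfix).symm]
      rw [← h.sum_eq x y hxy hxy' fun c hc => (hno' c hc).1]
      refine finsum_mem_congr rfl fun c hc => ?_
      rw [hf.entries, foldedEntry_eq_of_fixed hf.simplyLaced (hno' c hc).1 hfix]
    · have hsum : ∑ᶠ c ∈ Ioo x y, B (f (ε x)) (f (ε c)) =
          ∑ᶠ c ∈ Ioo x y, A (ε x) (ε c) + ∑ᶠ c ∈ Ioo x y, A (μ (ε x)) (ε c) := by
        rw [← finsum_mem_add_distrib hfin]
        refine finsum_mem_congr rfl fun c hc => ?_
        rw [hf.entries, foldedEntry_eq_add hf.simplyLaced (hno' c hc).1 (hno' c hc).2 hfix]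
      have hnc : ¬ Conc A (ε x) (μ (ε x)) := by
        rintro (e | e)
        · exact hfix e.symm
        · exact hf.not_adj _ (h.gcm.adj_symm e)
      rw [hsum]
      -- The two rows, of the label of `x` and of its image under `μ`, contribute `-2` and `0` if
      -- `x` and `y` have the same label, and `-1` each if `μ` exchanges their labels.
      rcases (hf.fibres _ _).1 hxyε with e | e
      · obtain ⟨z, hz⟩ := hε.fibred.nonempty (μ (ε x))
        rw [h.sum_eq x y hxy e.symm fun c hc => (hno' c hc).1, ← hz,
          h.sum_eq_zero hxy e.symm (by rwa [hz]) ?_ (fun c hc => by rw [hz]; exact (hno' c hc).2)]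
        · rfl
        · intro a b ha hb
          exact hcmp a b (Or.inl (by rw [ha, hz, hf.involutive, hb]))
      · rw [← e] at hnc hno' ⊢
        rw [h.sum_left_eq_neg_one hxy hnc ?_ fun c hc => (hno' c hc).1,
          h.sum_right_eq_neg_one hxy hnc ?_ fun c hc => (hno' c hc).2]
        · rfl
        · intro a b ha hb
          exact hcmp a b (Or.inl (by rw [ha, hb, e, hf.involutive]))
        · intro a b ha hb
          exact hcmp a b (Or.inl (by rw [ha, hb, e]))

end Folding

lemma IsSimplyFoldedFull.isFullOver {P : Type u} {E : Type v} [Fintype P] [PartialOrder E]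
    {A : Matrix P P ℤ} {ε : E → P} (hA : IsDoublyLacedGCM A) (hE : IsSimplyFoldedFull A ε) :
    IsFullOver A ε := by
  rcases hE with ⟨h1, h2⟩ | ⟨P', _, A', μ, f, ε', hf, hε, hcmp, rfl⟩
  · exact h2.isFullOver h1
  · exact hf.isFullOver hA hε hcmp

/-! ### Weights and heights of proper ideals under the operators -/

section Operators

variable {P : Type u} {E : Type v} [PartialOrder E] {A : Matrix P P ℤ} {ε : E → P}
  {I J : Set E} {a b : E} {p q i j : P}

lemma Removable.addable_sdiff (h : Removable a I) (hI : IsLowerSet I) : Addable a (I \ {a}) :=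
  ⟨fun h' => h'.2 rfl, by rwa [sdiff_union_self, union_eq_self_of_subset_right
    (singleton_subset_iff.2 h.1)]⟩

lemma Addable.removable_union (h : Addable a I) (hI : IsLowerSet I) :
    Removable a (I ∪ {a}) :=
  ⟨Or.inr rfl, by
    rwa [union_sdiff_right, sdiff_singleton_eq_self h.1]⟩

lemma Removable.le (h : Removable a I) (hb : b ∈ I) (hab : a ≤ b ∨ b ≤ a) : b ≤ a := by
  rcases hab with hab | hab
  · by_contra hba
    exact (h.2 hab ⟨hb, fun e => hba (e ▸ le_rfl)⟩).2 rfl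
  · exact hab

lemma Addable.le (h : Addable a I) (hb : b ∉ I) (hab : a ≤ b ∨ b ≤ a) : a ≤ b := by
  rcases hab with hab | hab
  · exact hab
  · rcases h.2 hab (Or.inr rfl) with h' | h'
    exacts [absurd h' hb, h' ▸ le_rfl]

lemma opS_of_removable (hch : ∀ a b, ε a = ε b → a ≤ b ∨ b ≤ a) (h : Removable a I) :
    opS ε (ε a) I = I \ {a} := by
  have hex : ∃ b, ε b = ε a ∧ Removable b I := ⟨a, rfl, h⟩
  rw [opS, dif_pos hex]
  have hs := hex.choose_spec
  congr 2
  -- Two removable elements of one fibre bound each other, so the chosen element is `a`.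
  exact le_antisymm (h.le hs.2.1 (hch _ _ hs.1.symm)) (hs.2.le h.1 (hch _ _ hs.1))

lemma opS_of_addable (hch : ∀ a b, ε a = ε b → a ≤ b ∨ b ≤ a) (h : Addable a I)
    (hno : ¬ ∃ b, ε b = ε a ∧ Removable b I) : opS ε (ε a) I = I ∪ {a} := by
  have hex : ∃ b, ε b = ε a ∧ Addable b I := ⟨a, rfl, h⟩
  rw [opS, dif_neg hno, dif_pos hex]
  have hs := hex.choose_spec
  congr 2
  exact le_antisymm (hs.2.le h.1 (hch _ _ hs.1)) (h.le hs.2.1 (hch _ _ hs.1.symm))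

lemma opS_of_not (h1 : ¬ ∃ a, ε a = i ∧ Removable a I) (h2 : ¬ ∃ a, ε a = i ∧ Addable a I) :
    opS ε i I = I := by
  rw [opS, dif_neg h1, dif_neg h2]

/-- `a` and `b` are consecutive elements of the fibre of `p`, with `a` inside and `b` outside of
the set `I`. -/
structure IsCut (ε : E → P) (p : P) (I : Set E) (a b : E) : Prop where
  left_label : ε a = p
  right_label : ε b = p
  lt : a < b
  left_mem : a ∈ I
  right_notMem : b ∉ I
  consecutive : ∀ c ∈ Ioo a b, ε c ≠ p

lemma IsFullOver.chain (h : IsFullOver A ε) (a b : E) (hab : ε a = ε b) : a ≤ b ∨ b ≤ a :=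
  h.heap.comparable a b (Or.inl hab)

lemma IsFullOver.finite_Ioo (h : IsFullOver A ε) (a b : E) : (Ioo a b).Finite :=
  (h.heap.locallyFinite a b).subset Ioo_subset_Icc_self

lemma lt_of_mem_of_notMem (hI : IsLowerSet I) (ha : a ∈ I) (hb : b ∉ I) (hab : a ≤ b ∨ b ≤ a) :
    a < b := by
  rcases hab with hab | hab
  · exact lt_of_le_of_ne hab fun e => hb (e ▸ ha)
  · exact absurd (hI hab ha) hb

lemma IsFullOver.exists_isCut (h : IsFullOver A ε) (hI : IsProperIdeal ε I) (p : P) :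
    ∃ a b, IsCut ε p I a b := by
  obtain ⟨a₀, ha₀, hap₀⟩ := hI.exists_mem p
  obtain ⟨b₀, hb₀, hbp₀⟩ := hI.exists_notMem p
  have hlt := lt_of_mem_of_notMem hI.isLowerSet ha₀ hb₀ (h.chain _ _ (hap₀.trans hbp₀.symm))
  have hfin := h.heap.locallyFinite a₀ b₀
  obtain ⟨a, ha⟩ := (hfin.subset (inter_subset_right (s := {x | ε x = p ∧ x ∈ I}))).exists_maximal
    ⟨a₀, ⟨hap₀, ha₀⟩, le_rfl, hlt.le⟩
  obtain ⟨b, hb⟩ := (hfin.subset (inter_subset_right (s := {x | ε x = p ∧ x ∉ I}))).exists_minimal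
    ⟨b₀, ⟨hbp₀, hb₀⟩, hlt.le, le_rfl⟩
  refine ⟨a, b, ha.1.1.1, hb.1.1.1, lt_of_mem_of_notMem hI.isLowerSet ha.1.1.2 hb.1.1.2
    (h.chain _ _ (ha.1.1.1.trans hb.1.1.1.symm)), ha.1.1.2, hb.1.1.2, fun c hc hcp => ?_⟩
  have hc' : c ∈ Icc a₀ b₀ := ⟨ha.1.2.1.trans hc.1.le, hc.2.le.trans hb.1.2.2⟩
  by_cases hcI : c ∈ I
  · exact (ha.2 ⟨⟨hcp, hcI⟩, hc'⟩ hc.1.le).not_gt hc.1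
  · exact (hb.2 ⟨⟨hcp, hcI⟩, hc'⟩ hc.2.le).not_gt hc.2

variable (A ε) in
open Classical in
/-- The `p`-th coordinate of the weight of an ideal: `1` if an element labelled `p` can be removed,
`-1` if such an element can be added, and `0` otherwise. -/
noncomputable def wt (p : P) (I : Set E) : ℤ :=
  (if ∃ a, ε a = p ∧ Removable a I then 1 else 0) - (if ∃ a, ε a = p ∧ Addable a I then 1 else 0)

namespace IsCut

lemma mem_Ioo (hI : IsLowerSet I) (hc : IsCut ε p I a b) {c : E} (hac : a ≤ c ∨ c ≤ a) (hbc : b ≤ c ∨ c ≤ b) (hcp : ε c ≠ p) :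
    c ∈ Ioo a b ∨ (c ∈ I ∧ c < a) ∨ (c ∉ I ∧ b < c) := by
  have hca : c ≠ a := fun e => hcp (e ▸ hc.left_label)
  have hcb : c ≠ b := fun e => hcp (e ▸ hc.right_label)
  rcases hac with h1 | h1
  · rcases hbc with h2 | h2
    · exact Or.inr (Or.inr ⟨fun h3 => hc.right_notMem (hI h2 h3), lt_of_le_of_ne h2 hcb.symm⟩)
    · exact Or.inl ⟨lt_of_le_of_ne h1 hca.symm, lt_of_le_of_ne h2 hcb⟩
  · exact Or.inr (Or.inl ⟨hI h1 hc.left_mem, lt_of_le_of_ne h1 hca⟩)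

lemma sum_add_sum (h : IsFullOver A ε) (hc : IsCut ε p I a b) :
    ∑ᶠ c ∈ Ioo a b ∩ I, A p (ε c) + ∑ᶠ c ∈ Ioo a b \ I, A p (ε c) = -2 := by
  rw [finsum_mem_inter_add_sdiff I (h.finite_Ioo a b)]
  have := h.sum_eq a b hc.lt (hc.left_label.trans hc.right_label.symm)
    (by rw [hc.left_label]; exact hc.consecutive)
  rwa [hc.left_label] at this

variable (h : IsFullOver A ε) (hI : IsLowerSet I) (hc : IsCut ε p I a b)
include h hI hc

lemma le_left {c : E} (hcI : c ∈ I) (hcp : ε c = p) : c ≤ a := by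
  by_contra hca
  have h1 : a < c := (h.chain a c (hc.left_label.trans hcp.symm)).elim
    (fun h' => lt_of_le_of_ne h' fun e => hca (e ▸ le_rfl)) fun h' => absurd h' hca
  have h2 := lt_of_mem_of_notMem hI hcI hc.right_notMem (h.chain c b (hcp.trans hc.right_label.symm))
  exact hc.consecutive c ⟨h1, h2⟩ hcp

lemma right_le {c : E} (hcI : c ∉ I) (hcp : ε c = p) : b ≤ c := by
  by_contra hca
  have h1 : c < b := (h.chain b c (hc.right_label.trans hcp.symm)).elim
    (fun h' => absurd h' hca) fun h' => lt_of_le_of_ne h' fun e => hca (e ▸ le_rfl)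
  have h2 := lt_of_mem_of_notMem hI hc.left_mem hcI (h.chain a c (hc.left_label.trans hcp.symm))
  exact hc.consecutive c ⟨h2, h1⟩ hcp

lemma eq_left {c : E} (hr : Removable c I) (hcp : ε c = p) : c = a :=
  le_antisymm (hc.le_left h hI hr.1 hcp)
    (hr.le hc.left_mem (h.chain _ _ (hcp.trans hc.left_label.symm)))

lemma eq_right {c : E} (hr : Addable c I) (hcp : ε c = p) : c = b :=
  le_antisymm (hr.le hc.right_notMem (h.chain _ _ (hcp.trans hc.right_label.symm)))
    (hc.right_le h hI hr.1 hcp)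

/-- An obstruction to removing `a` is an element of `I` above it. The first concurrent step towards
it lies in `I`, has a label adjacent to `p` because `a` is the last of its fibre in `I`, and is
therefore comparable to `b` and below it: a negative term of the sum. -/
lemma removable_iff : Removable a I ↔ ∑ᶠ c ∈ Ioo a b ∩ I, A p (ε c) = 0 := by
  have hneg : ∀ c ∈ Ioo a b ∩ I, A p (ε c) ≤ 0 := fun c hcm =>
    h.gcm.nonpos (hc.consecutive c hcm.1).symm
  constructor
  · intro hr
    refine finsum_mem_eq_zero_of_forall_eq_zero fun c hcm => ?_
    exact absurd (hr.le hcm.2 (Or.inl hcm.1.1.le)) hcm.1.1.not_ge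
  · intro hs
    refine ⟨hc.left_mem, fun x y hyx hx => ⟨hI hyx hx.1, ?_⟩⟩
    rintro rfl
    have hlt : y < x := lt_of_le_of_ne hyx fun e => hx.2 e.symm
    obtain ⟨c, h1, h2, h3⟩ := h.heap.exists_conc_above hlt
    have hcI : c ∈ I := hI h2 hx.1
    rw [hc.left_label] at h3
    rcases h3 with h3 | h3
    · exact h1.not_ge (hc.le_left h hI hcI h3.symm)
    · have hcb := lt_of_mem_of_notMem hI hcI hc.right_notMem (h.heap.comparable c b
        (by rw [hc.right_label]; exact Or.inr (h.gcm.adj_symm h3)))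
      have := finsum_mem_le_of_mem ((h.finite_Ioo y b).subset inter_subset_left) hneg
        (x := c) ⟨⟨h1, hcb⟩, hcI⟩
      have h4 := hneg c ⟨⟨h1, hcb⟩, hcI⟩
      exact h3.2 (by omega)

lemma addable_iff : Addable b I ↔ ∑ᶠ c ∈ Ioo a b \ I, A p (ε c) = 0 := by
  have hneg : ∀ c ∈ Ioo a b \ I, A p (ε c) ≤ 0 := fun c hcm =>
    h.gcm.nonpos (hc.consecutive c hcm.1).symm
  constructor
  · intro hr
    refine finsum_mem_eq_zero_of_forall_eq_zero fun c hcm => ?_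
    exact absurd (hr.le hcm.2 (Or.inr hcm.1.2.le)) hcm.1.2.not_ge
  · intro hs
    refine ⟨hc.right_notMem, fun x y hyx hx => ?_⟩
    rcases hx with hx | hx
    · exact Or.inl (hI hyx hx)
    obtain rfl : x = b := hx
    by_contra hy
    have hyI : y ∉ I := fun h' => hy (Or.inl h')
    have hlt : y < x := lt_of_le_of_ne hyx fun e => hy (Or.inr e)
    obtain ⟨c, h1, h2, h3⟩ := h.heap.exists_conc_below hlt
    have hcI : c ∉ I := fun h' => hyI (hI h1 h')
    rw [hc.right_label] at h3
    rcases h3 with h3 | h3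
    · exact h2.not_ge (hc.right_le h hI hcI h3)
    · have hcb := lt_of_mem_of_notMem hI hc.left_mem hcI (h.heap.comparable a c
        (by rw [hc.left_label]; exact Or.inr (h.gcm.adj_symm h3)))
      have := finsum_mem_le_of_mem ((h.finite_Ioo a x).subset sdiff_subset) hneg
        (x := c) ⟨⟨hcb, h2⟩, hcI⟩
      have h4 := hneg c ⟨⟨hcb, h2⟩, hcI⟩
      exact (h.gcm.adj_symm h3).2 (by omega)

lemma exists_removable_iff : (∃ c, ε c = p ∧ Removable c I) ↔ Removable a I :=
  ⟨fun ⟨_, hp, hr⟩ => hc.eq_left h hI hr hp ▸ hr, fun hr => ⟨a, hc.left_label, hr⟩⟩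

lemma exists_addable_iff : (∃ c, ε c = p ∧ Addable c I) ↔ Addable b I :=
  ⟨fun ⟨_, hp, hr⟩ => hc.eq_right h hI hr hp ▸ hr, fun hr => ⟨b, hc.right_label, hr⟩⟩

/-- The sums inside and outside `I` can only be `(0, -2)`, `(-1, -1)` or `(-2, 0)`: removable,
neither, addable. This makes the weight linear in the contents of `I`. -/
lemma wt_eq : wt ε p I = 1 + ∑ᶠ c ∈ Ioo a b ∩ I, A p (ε c) := by
  have hs := hc.sum_add_sum h
  have n1 : ∑ᶠ c ∈ Ioo a b ∩ I, A p (ε c) ≤ 0 :=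
    finsum_mem_nonpos ((h.finite_Ioo a b).subset inter_subset_left)
      fun c hcm => h.gcm.nonpos (hc.consecutive c hcm.1).symm
  have n2 : ∑ᶠ c ∈ Ioo a b \ I, A p (ε c) ≤ 0 :=
    finsum_mem_nonpos ((h.finite_Ioo a b).subset sdiff_subset)
      fun c hcm => h.gcm.nonpos (hc.consecutive c hcm.1).symm
  rw [wt, hc.exists_removable_iff h hI, hc.exists_addable_iff h hI, hc.removable_iff h hI,
    hc.addable_iff h hI]
  split_ifs <;> omega

lemma not_removable_and_addable : ¬ (Removable a I ∧ Addable b I) := by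
  rw [hc.removable_iff h hI, hc.addable_iff h hI]
  have := hc.sum_add_sum h
  omega

end IsCut

lemma IsFullOver.not_removable_of_addable (h : IsFullOver A ε) (hI : IsProperIdeal ε I)
    (ha : Addable a I) : ¬ ∃ b, ε b = ε a ∧ Removable b I := by
  obtain ⟨x, y, hc⟩ := h.exists_isCut hI (ε a)
  rw [hc.exists_removable_iff h hI.isLowerSet]
  have hy := hc.eq_right h hI.isLowerSet ha rfl
  exact fun hr => hc.not_removable_and_addable h hI.isLowerSet ⟨hr, hy ▸ ha⟩

lemma IsFullOver.not_addable_of_removable (h : IsFullOver A ε) (hI : IsProperIdeal ε I)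
    (ha : Removable a I) : ¬ ∃ b, ε b = ε a ∧ Addable b I := by
  rintro ⟨b, hb, hb'⟩
  exact h.not_removable_of_addable hI hb' ⟨a, hb.symm, ha⟩

lemma IsFullOver.wt_of_addable (h : IsFullOver A ε) (hI : IsProperIdeal ε I)
    (ha : Addable a I) : wt ε (ε a) I = -1 := by
  rw [wt, if_neg (h.not_removable_of_addable hI ha), if_pos ⟨a, rfl, ha⟩]
  rfl

lemma IsFullOver.wt_of_removable (h : IsFullOver A ε) (hI : IsProperIdeal ε I)
    (ha : Removable a I) : wt ε (ε a) I = 1 := by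
  rw [wt, if_neg (h.not_addable_of_removable hI ha), if_pos ⟨a, rfl, ha⟩]
  rfl

lemma IsFullOver.isProperIdeal_union (h : IsFullOver A ε) (hI : IsProperIdeal ε I)
    (ha : Addable a I) : IsProperIdeal ε (I ∪ {a}) := by
  have key : ∀ p, ∃ b, b ∉ I ∪ {a} ∧ ε b = p := by
    intro p
    by_cases hp : ε a = p
    · obtain ⟨b, hb, hab⟩ := h.unbounded_above a
      refine ⟨b, ?_, hb.trans hp⟩
      rintro (hbI | hba)
      · exact ha.1 (hI.isLowerSet hab.le hbI)
      · exact hab.ne' hba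
    · obtain ⟨b, hb, hbp⟩ := hI.exists_notMem p
      refine ⟨b, ?_, hbp⟩
      rintro (hbI | rfl)
      exacts [hb hbI, hp hbp]
  refine ⟨ha.2, hI.nonempty.mono subset_union_left, fun e => ?_, fun p => ?_, key⟩
  · obtain ⟨b, hb, -⟩ := key (ε a)
    exact hb (e ▸ mem_univ b)
  · obtain ⟨b, hb, hbp⟩ := hI.exists_mem p
    exact ⟨b, Or.inl hb, hbp⟩

lemma IsFullOver.isProperIdeal_sdiff (h : IsFullOver A ε) (hI : IsProperIdeal ε I)
    (ha : Removable a I) : IsProperIdeal ε (I \ {a}) := by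
  have key : ∀ p, ∃ b, b ∈ I \ {a} ∧ ε b = p := by
    intro p
    by_cases hp : ε a = p
    · obtain ⟨b, hb, hab⟩ := h.unbounded_below a
      exact ⟨b, ⟨hI.isLowerSet hab.le ha.1, hab.ne⟩, hb.trans hp⟩
    · obtain ⟨b, hb, hbp⟩ := hI.exists_mem p
      refine ⟨b, ⟨hb, ?_⟩, hbp⟩
      rintro rfl
      exact hp hbp
  refine ⟨ha.2, ?_, fun e => ?_, key, fun p => ?_⟩
  · obtain ⟨b, hb, -⟩ := key (ε a)
    exact ⟨b, hb⟩
  · exact (e ▸ mem_univ a : a ∈ I \ {a}).2 rfl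
  · obtain ⟨b, hb, hbp⟩ := hI.exists_notMem p
    exact ⟨b, fun h' => hb h'.1, hbp⟩

lemma IsFullOver.wt_union (h : IsFullOver A ε) (hI : IsProperIdeal ε I) (ha : Addable a I)
    (q : P) : wt ε q (I ∪ {a}) = wt ε q I + A q (ε a) := by
  have hI' := h.isProperIdeal_union hI ha
  by_cases hq : ε a = q
  · subst hq
    rw [h.wt_of_addable hI ha, h.wt_of_removable hI' (ha.removable_union hI.isLowerSet),
      h.gcm.diag]
    rfl
  obtain ⟨x, y, hc⟩ := h.exists_isCut hI q
  have hc' : IsCut ε q (I ∪ {a}) x y := ⟨hc.left_label, hc.right_label, hc.lt, Or.inl hc.left_mem,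
    by rintro (h1 | rfl); exacts [hc.right_notMem h1, hq hc.right_label], hc.consecutive⟩
  rw [hc.wt_eq h hI.isLowerSet, hc'.wt_eq h hI'.isLowerSet]
  by_cases hm : a ∈ Ioo x y
  · have : Ioo x y ∩ (I ∪ {a}) = insert a (Ioo x y ∩ I) := by
      rw [union_singleton, inter_insert_of_mem hm]
    rw [this, finsum_mem_insert _ (fun h' => ha.1 h'.2)
      ((h.finite_Ioo x y).subset inter_subset_left)]
    ring
  · have : Ioo x y ∩ (I ∪ {a}) = Ioo x y ∩ I := by
      rw [union_singleton, inter_insert_of_notMem hm]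
    rw [this]
    -- An adjacent label would make `a` comparable to both ends of the cut, forcing it into the
    -- interval: it is not in `I`, and being addable it cannot lie above `y`.
    have hz : A q (ε a) = 0 := by
      by_contra hne
      have hconc : Conc A q (ε a) := Or.inr ⟨fun e => hq e.symm, hne⟩
      rcases hc.mem_Ioo hI.isLowerSet (h.heap.comparable x a (by rwa [hc.left_label]))
        (h.heap.comparable y a (by rwa [hc.right_label])) hq with h1 | h1 | h1
      · exact hm h1
      · exact ha.1 h1.1
      · exact h1.2.not_ge (ha.le hc.right_notMem (Or.inr h1.2.le))
    rw [hz, add_zero]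

/-! ### Heights relative to a base ideal -/

variable (ε) in
/-- The number of elements labelled `p` in `I`, relative to the base ideal `J`. -/
noncomputable def height (J : Set E) (p : P) (I : Set E) : ℤ :=
  ((I \ J) ∩ ε ⁻¹' {p}).ncard - ((J \ I) ∩ ε ⁻¹' {p}).ncard

lemma IsFullOver.finite_sdiff (h : IsFullOver A ε) (hI : IsProperIdeal ε I)
    (hJ : IsProperIdeal ε J) (p : P) : ((I \ J) ∩ ε ⁻¹' {p}).Finite := by
  obtain ⟨x, hx, hxp⟩ := hJ.exists_mem p
  obtain ⟨y, hy, hyp⟩ := hI.exists_notMem p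
  refine (h.heap.locallyFinite x y).subset fun c hc => ⟨?_, ?_⟩
  · exact (lt_of_mem_of_notMem hJ.isLowerSet hx hc.1.2 (h.chain _ _ (hxp.trans hc.2.symm))).le
  · exact (lt_of_mem_of_notMem hI.isLowerSet hc.1.1 hy (h.chain _ _ (hc.2.trans hyp.symm))).le

lemma IsFullOver.height_union [DecidableEq P] (h : IsFullOver A ε) (hI : IsProperIdeal ε I)
    (hJ : IsProperIdeal ε J) (ha : Addable a I) (p : P) :
    height ε J p (I ∪ {a}) = height ε J p I + if ε a = p then 1 else 0 := by
  have f1 := h.finite_sdiff hI hJ p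
  have f2 := h.finite_sdiff hJ (h.isProperIdeal_union hI ha) p
  unfold height
  split_ifs with hp
  · by_cases haJ : a ∈ J
    · have e1 : ((I ∪ {a}) \ J) ∩ ε ⁻¹' {p} = (I \ J) ∩ ε ⁻¹' {p} := by
        ext c; simp only [mem_inter_iff, mem_sdiff, mem_union, mem_singleton_iff]; grind
      have e2 : (J \ I) ∩ ε ⁻¹' {p} = insert a ((J \ (I ∪ {a})) ∩ ε ⁻¹' {p}) := by
        have := ha.1
        ext c
        simp only [mem_inter_iff, mem_sdiff, mem_union, mem_singleton_iff, mem_insert_iff,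
          mem_preimage]
        grind
      rw [e1, e2, ncard_insert_of_notMem (fun h' => h'.1.2 (Or.inr rfl)) f2]
      push_cast; ring
    · have e1 : (J \ (I ∪ {a})) ∩ ε ⁻¹' {p} = (J \ I) ∩ ε ⁻¹' {p} := by
        ext c; simp only [mem_inter_iff, mem_sdiff, mem_union, mem_singleton_iff]; grind
      have e2 : ((I ∪ {a}) \ J) ∩ ε ⁻¹' {p} = insert a ((I \ J) ∩ ε ⁻¹' {p}) := by
        ext c
        simp only [mem_inter_iff, mem_sdiff, mem_union, mem_singleton_iff, mem_insert_iff,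
          mem_preimage]
        grind
      rw [e1, e2, ncard_insert_of_notMem (fun h' => ha.1 h'.1.1) f1]
      push_cast; ring
  · have e1 : ((I ∪ {a}) \ J) ∩ ε ⁻¹' {p} = (I \ J) ∩ ε ⁻¹' {p} := by
      ext c
      simp only [mem_inter_iff, mem_sdiff, mem_union, mem_singleton_iff, mem_preimage]
      grind
    have e2 : (J \ (I ∪ {a})) ∩ ε ⁻¹' {p} = (J \ I) ∩ ε ⁻¹' {p} := by
      ext c
      simp only [mem_inter_iff, mem_sdiff, mem_union, mem_singleton_iff, mem_preimage]
      grind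
    rw [e1, e2, add_zero]

/-- A proper ideal is determined by its heights. -/
lemma IsFullOver.eq_of_height_eq (h : IsFullOver A ε) {K : Set E} (hI : IsProperIdeal ε I)
    (hJ : IsProperIdeal ε J) (hK : IsProperIdeal ε K)
    (he : ∀ p, height ε K p I = height ε K p J) : I = J := by
  -- If the fibre of `I` is contained in that of `J`, then passing to `J` enlarges the first set in
  -- `height` and shrinks the second, so equal heights force equality of both.
  have main : ∀ {I J : Set E}, IsProperIdeal ε I → IsProperIdeal ε J →
      ∀ p, height ε K p I = height ε K p J → I ∩ ε ⁻¹' {p} ⊆ J → J ∩ ε ⁻¹' {p} ⊆ I := by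
    intro I J hI hJ p he hsub x hx
    have s1 : (I \ K) ∩ ε ⁻¹' {p} ⊆ (J \ K) ∩ ε ⁻¹' {p} :=
      fun c hc => ⟨⟨hsub ⟨hc.1.1, hc.2⟩, hc.1.2⟩, hc.2⟩
    have s2 : (K \ J) ∩ ε ⁻¹' {p} ⊆ (K \ I) ∩ ε ⁻¹' {p} :=
      fun c hc => ⟨⟨hc.1.1, fun h' => hc.1.2 (hsub ⟨h', hc.2⟩)⟩, hc.2⟩
    have f1 := h.finite_sdiff hJ hK p
    have f2 := h.finite_sdiff hK hI p
    have n1 := ncard_le_ncard s1 f1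
    have n2 := ncard_le_ncard s2 f2
    unfold height at he
    have t1 := eq_of_subset_of_ncard_le s1 (by omega) f1
    have t2 := eq_of_subset_of_ncard_le s2 (by omega) f2
    by_contra hxI
    by_cases hxK : x ∈ K
    · exact (t2 ▸ (⟨⟨hxK, hxI⟩, hx.2⟩ : x ∈ (K \ I) ∩ ε ⁻¹' {p}) :
        x ∈ (K \ J) ∩ ε ⁻¹' {p}).1.2 hx.1
    · exact hxI (t1 ▸ (⟨⟨hx.1, hxK⟩, hx.2⟩ : x ∈ (J \ K) ∩ ε ⁻¹' {p}) :
        x ∈ (I \ K) ∩ ε ⁻¹' {p}).1.1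
  -- Lower sets meet a chain in nested subsets.
  have tot : ∀ p, I ∩ ε ⁻¹' {p} ⊆ J ∨ J ∩ ε ⁻¹' {p} ⊆ I := by
    intro p
    by_contra! hcon
    obtain ⟨x, hx, hxJ⟩ := not_subset.1 hcon.1
    obtain ⟨y, hy, hyI⟩ := not_subset.1 hcon.2
    have hxy := h.chain x y (hx.2.trans hy.2.symm)
    exact (lt_of_mem_of_notMem hI.isLowerSet hx.1 hyI hxy).not_gt
      (lt_of_mem_of_notMem hJ.isLowerSet hy.1 hxJ hxy.symm)
  ext x
  rcases tot (ε x) with h1 | h1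
  · exact ⟨fun hx => h1 ⟨hx, rfl⟩, fun hx => main hI hJ (ε x) (he _) h1 ⟨hx, rfl⟩⟩
  · exact ⟨fun hx => main hJ hI (ε x) (he _).symm h1 ⟨hx, rfl⟩, fun hx => h1 ⟨hx, rfl⟩⟩

/-- The possible effects of the operator `S_i` on a proper ideal. -/
lemma IsFullOver.opS_cases (h : IsFullOver A ε) (hI : IsProperIdeal ε I) (i : P) :
    (∃ a, ε a = i ∧ Removable a I ∧ opS ε i I = I \ {a} ∧ wt ε i I = 1) ∨
    (∃ a, ε a = i ∧ Addable a I ∧ opS ε i I = I ∪ {a} ∧ wt ε i I = -1) ∨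
    (opS ε i I = I ∧ wt ε i I = 0) := by
  by_cases h1 : ∃ a, ε a = i ∧ Removable a I
  · obtain ⟨a, rfl, ha⟩ := h1
    exact Or.inl ⟨a, rfl, ha, opS_of_removable h.chain ha, h.wt_of_removable hI ha⟩
  by_cases h2 : ∃ a, ε a = i ∧ Addable a I
  · obtain ⟨a, rfl, ha⟩ := h2
    exact Or.inr (Or.inl ⟨a, rfl, ha, opS_of_addable h.chain ha h1, h.wt_of_addable hI ha⟩)
  · exact Or.inr (Or.inr ⟨opS_of_not h1 h2, by rw [wt, if_neg h1, if_neg h2]; rfl⟩)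

lemma IsFullOver.isProperIdeal_opS (h : IsFullOver A ε) (hI : IsProperIdeal ε I) (i : P) :
    IsProperIdeal ε (opS ε i I) := by
  rcases h.opS_cases hI i with ⟨a, -, ha, e, -⟩ | ⟨a, -, ha, e, -⟩ | ⟨e, -⟩ <;> rw [e]
  exacts [h.isProperIdeal_sdiff hI ha, h.isProperIdeal_union hI ha, hI]

/-- The three cases of `opS` merge into one formula, a simple reflection, because the weight is `1`,
`-1` or `0` accordingly. -/
lemma IsFullOver.wt_opS (h : IsFullOver A ε) (hI : IsProperIdeal ε I) (i q : P) :
    wt ε q (opS ε i I) = wt ε q I - A q i * wt ε i I := by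
  rcases h.opS_cases hI i with ⟨a, rfl, ha, e, w⟩ | ⟨a, rfl, ha, e, w⟩ | ⟨e, w⟩ <;> rw [e, w]
  · have := h.wt_union (h.isProperIdeal_sdiff hI ha) (ha.addable_sdiff hI.isLowerSet) q
    rw [sdiff_union_self, union_eq_self_of_subset_right (singleton_subset_iff.2 ha.1)] at this
    rw [this]; ring
  · rw [h.wt_union hI ha]; ring
  · ring

lemma IsFullOver.height_opS [DecidableEq P] (h : IsFullOver A ε) (hI : IsProperIdeal ε I)
    (hJ : IsProperIdeal ε J) (i p : P) :
    height ε J p (opS ε i I) = height ε J p I - if i = p then wt ε i I else 0 := by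
  rcases h.opS_cases hI i with ⟨a, rfl, ha, e, w⟩ | ⟨a, rfl, ha, e, w⟩ | ⟨e, w⟩ <;> rw [e, w]
  · have := h.height_union (h.isProperIdeal_sdiff hI ha) hJ (ha.addable_sdiff hI.isLowerSet) p
    rw [sdiff_union_self, union_eq_self_of_subset_right (singleton_subset_iff.2 ha.1)] at this
    rw [this]; ring
  · rw [h.height_union hI hJ ha]; split_ifs <;> ring
  · simp

end Operators

/-! ### The Weyl group action, transitivity and duality -/

section Action

variable {P : Type u} {E : Type v} [PartialOrder E] {A : Matrix P P ℤ} {ε : E → P}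

/-- The operator `S_i` on the set of proper ideals. -/
noncomputable def IsFullOver.op (h : IsFullOver A ε) (i : P) (I : ProperIdeal ε) : ProperIdeal ε :=
  ⟨opS ε i I, h.isProperIdeal_opS I.2 i⟩

lemma IsFullOver.wt_op (h : IsFullOver A ε) (i q : P) (I : ProperIdeal ε) :
    wt ε q (h.op i I : Set E) = wt ε q (I : Set E) - A q i * wt ε i (I : Set E) :=
  h.wt_opS I.2 i q

lemma IsFullOver.height_op [DecidableEq P] (h : IsFullOver A ε) (J : ProperIdeal ε) (i p : P)
    (I : ProperIdeal ε) :
    height ε (J : Set E) p (h.op i I : Set E) =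
      height ε (J : Set E) p (I : Set E) - if i = p then wt ε i (I : Set E) else 0 :=
  h.height_opS I.2 J.2 i p

lemma IsFullOver.ext_height (h : IsFullOver A ε) {I J : ProperIdeal ε} (K : ProperIdeal ε)
    (he : ∀ p, height ε (K : Set E) p (I : Set E) = height ε (K : Set E) p (J : Set E)) :
    I = J :=
  Subtype.ext (h.eq_of_height_eq I.2 J.2 K.2 he)

lemma IsFullOver.op_involutive (h : IsFullOver A ε) (i : P) : Function.Involutive (h.op i) := by
  classical
  intro I
  -- Any base ideal would do; `I` itself is at hand.
  refine h.ext_height I fun p => ?_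
  simp only [h.height_op, h.wt_op, h.gcm.diag]
  split_ifs <;> ring

lemma IsFullOver.op_comm (h : IsFullOver A ε) {i j : P} (hij : A i j = 0) (I : ProperIdeal ε) :
    h.op i (h.op j I) = h.op j (h.op i I) := by
  classical
  refine h.ext_height I fun p => ?_
  simp only [h.height_op, h.wt_op, hij, (h.gcm.zero_iff i j).1 hij]
  split_ifs <;> ring

lemma IsFullOver.op_braid₃ (h : IsFullOver A ε) {i j : P} (hij : A i j = -1) (hji : A j i = -1)
    (I : ProperIdeal ε) :
    h.op i (h.op j (h.op i I)) = h.op j (h.op i (h.op j I)) := by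
  classical
  refine h.ext_height I fun p => ?_
  simp only [h.height_op, h.wt_op, hij, hji, h.gcm.diag]
  split_ifs <;> ring

lemma IsFullOver.op_braid₄ (h : IsFullOver A ε) {i j : P} (hij : A i j * A j i = 2)
    (I : ProperIdeal ε) :
    h.op i (h.op j (h.op i (h.op j I))) = h.op j (h.op i (h.op j (h.op i I))) := by
  classical
  refine h.ext_height I fun p => ?_
  simp only [h.height_op, h.wt_op, h.gcm.diag]
  split_ifs
  -- The cases record which of `i`, `j` equal `p`; the two heights differ by a multiple of `A i j *
  -- A j i - 2`.
  · linear_combination (A i j * wt ε j (I : Set E) - A j i * wt ε i (I : Set E)) * hij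
  · linear_combination (-A j i * wt ε i (I : Set E)) * hij
  · linear_combination (A i j * wt ε j (I : Set E)) * hij
  · ring

/-- The operator `S_i` as a permutation of the set of proper ideals. -/
noncomputable def IsFullOver.perm (h : IsFullOver A ε) (i : P) : Equiv.Perm (ProperIdeal ε) :=
  (h.op_involutive i).toPerm

/-- The action of the Weyl group on the set of proper ideals, as a homomorphism. -/
noncomputable def IsFullOver.weylHom (h : IsFullOver A ε) :
    WeylGroup A →* Equiv.Perm (ProperIdeal ε) :=
  PresentedGroup.toGroup (f := h.perm) <| by
    intro r hr
    cases hr with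
    | sq i =>
      simp only [map_mul, FreeGroup.lift_apply_of]
      exact Equiv.ext fun I => h.op_involutive i I
    | comm i j hij =>
      simp only [map_mul, map_inv, FreeGroup.lift_apply_of, mul_inv_eq_one]
      exact Equiv.ext fun I => h.op_comm hij I
    | braid3 i j hneg hprod =>
      simp only [map_mul, map_inv, FreeGroup.lift_apply_of, mul_inv_eq_one]
      have hne : i ≠ j := by rintro rfl; rw [h.gcm.diag] at hneg; omega
      have hij : A i j = -1 := by
        rcases h.gcm.offDiag i j hne with e | e | e <;> rw [e] at hprod <;> omega
      have hji : A j i = -1 := by rw [hij] at hprod; omega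
      exact Equiv.ext fun I => h.op_braid₃ hij hji I
    | braid4 i j hneg hprod =>
      simp only [map_mul, map_inv, FreeGroup.lift_apply_of, mul_inv_eq_one]
      exact Equiv.ext fun I => h.op_braid₄ hprod I

lemma IsFullOver.weylHom_simpleReflection (h : IsFullOver A ε) (i : P) (I : ProperIdeal ε) :
    h.weylHom (simpleReflection A i) I = h.op i I := by
  rw [weylHom, simpleReflection, PresentedGroup.toGroup.of]
  rfl

/-! ### Transitivity -/

/-- A smaller proper ideal can be reached from a larger one by removing elements. -/
lemma IsFullOver.exists_weylHom_of_subset [Finite P] (h : IsFullOver A ε) (J : ProperIdeal ε)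
    (n : ℕ) : ∀ I : ProperIdeal ε, (J : Set E) ⊆ I → ((I : Set E) \ J).ncard = n →
    ∃ w, h.weylHom w I = J := by
  induction n with
  | zero =>
    intro I hJI hn
    -- Needed since `ncard` is also `0` on infinite sets; finiteness of `P` enters here.
    have hfin : ((I : Set E) \ J).Finite := by
      refine (finite_iUnion fun p => h.finite_sdiff I.2 J.2 p).subset fun c hc => ?_
      exact mem_iUnion.2 ⟨ε c, hc, rfl⟩
    rw [ncard_eq_zero hfin, sdiff_eq_empty] at hn
    exact ⟨1, by rw [map_one]; exact Subtype.ext (hn.antisymm hJI)⟩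
  | succ n ih =>
    intro I hJI hn
    have hfin : ((I : Set E) \ J).Finite := finite_of_ncard_ne_zero (by omega)
    obtain ⟨a, ha⟩ := hfin.exists_maximal (nonempty_of_ncard_ne_zero (by omega))
    -- An element of `I` above `a` is outside `J`, as `J` is a lower set, so it equals `a` by
    -- maximality.
    have hr : Removable a (I : Set E) := by
      refine ⟨ha.1.1, fun x y hyx hx => ⟨I.2.isLowerSet hyx hx.1, ?_⟩⟩
      rintro rfl
      exact hx.2 (le_antisymm
        (ha.2 ⟨hx.1, fun hxJ => ha.1.2 (J.2.isLowerSet hyx hxJ)⟩ hyx) hyx)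
    have hop : (h.op (ε a) I : Set E) = (I : Set E) \ {a} := opS_of_removable h.chain hr
    obtain ⟨w, hw⟩ := ih (h.op (ε a) I)
      (by rw [hop]; exact fun x hx => ⟨hJI hx, fun e => ha.1.2 (e ▸ hx)⟩)
      (by rw [hop, sdiff_sdiff_comm, ncard_sdiff_singleton_of_mem ha.1, hn]; rfl)
    refine ⟨w * simpleReflection A (ε a), ?_⟩
    rw [map_mul, Equiv.Perm.mul_apply, h.weylHom_simpleReflection, hw]

lemma IsFullOver.isProperIdeal_inter (h : IsFullOver A ε) {I J : Set E} (hI : IsProperIdeal ε I)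
    (hJ : IsProperIdeal ε J) : IsProperIdeal ε (I ∩ J) := by
  have key : ∀ p, ∃ a, a ∈ I ∩ J ∧ ε a = p := by
    intro p
    obtain ⟨x, hx, hxp⟩ := hI.exists_mem p
    obtain ⟨y, hy, hyp⟩ := hJ.exists_mem p
    rcases h.chain x y (hxp.trans hyp.symm) with hxy | hxy
    · exact ⟨x, ⟨hx, hJ.isLowerSet hxy hy⟩, hxp⟩
    · exact ⟨y, ⟨hI.isLowerSet hxy hx, hy⟩, hyp⟩
  refine ⟨hI.isLowerSet.inter hJ.isLowerSet, ?_, ?_, key, fun p => ?_⟩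
  · obtain ⟨x, -⟩ := hI.nonempty
    obtain ⟨y, hy, -⟩ := key (ε x)
    exact ⟨y, hy⟩
  · exact fun e => hI.ne_univ (univ_subset_iff.1 (e ▸ inter_subset_left))
  · obtain ⟨x, hx, hxp⟩ := hI.exists_notMem p
    exact ⟨x, fun h' => hx h'.1, hxp⟩

/-- Both ideals descend to their intersection; one descent is then inverted. -/
lemma IsFullOver.exists_weylHom [Finite P] (h : IsFullOver A ε) (I J : ProperIdeal ε) :
    ∃ w, h.weylHom w I = J := by
  let K : ProperIdeal ε := ⟨I ∩ J, h.isProperIdeal_inter I.2 J.2⟩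
  obtain ⟨v, hv⟩ := h.exists_weylHom_of_subset K _ I inter_subset_left rfl
  obtain ⟨w, hw⟩ := h.exists_weylHom_of_subset K _ J inter_subset_right rfl
  refine ⟨w⁻¹ * v, ?_⟩
  rw [map_mul, map_inv, Equiv.Perm.mul_apply, hv, Equiv.Perm.inv_eq_iff_eq, hw]

/-- The principal ideal generated by an element is proper. -/
lemma IsFullOver.isProperIdeal_Iic (h : IsFullOver A ε) (a : E) : IsProperIdeal ε (Iic a) := by
  -- Every fibre has elements on both sides of `a`. This spreads along paths of the connected
  -- diagram, since an element has elements of each adjacent fibre below and above it.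
  have key : ∀ p, (∃ b, ε b = p ∧ b < a) ∧ ∃ b, ε b = p ∧ a < b := by
    intro p
    induction h.connected (ε a) p with
    | refl => exact ⟨h.unbounded_below a, h.unbounded_above a⟩
    | @tail q r _ hqr ih =>
      obtain ⟨⟨b, rfl, hb⟩, ⟨c, hcb, hc⟩⟩ := ih
      obtain ⟨y, hy⟩ := h.exists_label r
      have hcmp : ∀ x, ε x = ε b → ∀ z, ε z = ε y → z ≤ x ∨ x ≤ z := fun x hx z hz =>
        h.heap.comparable z x (by rw [hz, hy, hx]; exact Or.inr (h.gcm.adj_symm hqr))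
      obtain ⟨d, hd, hdb, -⟩ := h.exists_last_below (hcmp b rfl)
      obtain ⟨e, he, hce, -⟩ := h.exists_first_above (hcmp c hcb)
      exact ⟨⟨d, hd.trans hy, hdb.trans hb⟩, ⟨e, he.trans hy, hc.trans hce⟩⟩
  refine ⟨isLowerSet_Iic a, ⟨a, le_rfl⟩, fun e => ?_, fun p => ?_, fun p => ?_⟩
  · obtain ⟨-, b, -, hb⟩ := key (ε a)
    exact hb.not_ge (e ▸ mem_univ b : b ∈ Iic a)
  · obtain ⟨⟨b, hbp, hb⟩, -⟩ := key p
    exact ⟨b, hb.le, hbp⟩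
  · obtain ⟨-, b, hbp, hb⟩ := key p
    exact ⟨b, hb.not_ge, hbp⟩

/-! ### The dual heap -/

/-- Complementation, as a bijection from the proper ideals of a heap to those of its dual. -/
def complEquiv (ε : E → P) : ProperIdeal ε ≃ ProperIdeal (dualLabel ε) where
  toFun I := ⟨OrderDual.ofDual ⁻¹' (I : Set E)ᶜ,
    { isLowerSet := isLowerSet_preimage_ofDual_iff.2 I.2.isLowerSet.compl
      nonempty := nonempty_compl.2 I.2.ne_univ
      ne_univ := fun e => by
        obtain ⟨a, ha⟩ := I.2.nonempty
        exact (e ▸ mem_univ (OrderDual.toDual a) :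
          OrderDual.toDual a ∈ OrderDual.ofDual ⁻¹' (I : Set E)ᶜ) ha
      exists_mem := I.2.exists_notMem
      exists_notMem := fun p => (I.2.exists_mem p).imp fun _ ha => ⟨not_not_intro ha.1, ha.2⟩ }⟩
  invFun J := ⟨OrderDual.toDual ⁻¹' (J : Set Eᵒᵈ)ᶜ,
    { isLowerSet := isLowerSet_preimage_toDual_iff.2 J.2.isLowerSet.compl
      nonempty := nonempty_compl.2 J.2.ne_univ
      ne_univ := fun e => by
        obtain ⟨a, ha⟩ := J.2.nonempty
        exact (e ▸ mem_univ (OrderDual.ofDual a) :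
          OrderDual.ofDual a ∈ OrderDual.toDual ⁻¹' (J : Set Eᵒᵈ)ᶜ) ha
      exists_mem := J.2.exists_notMem
      exists_notMem := fun p => (J.2.exists_mem p).imp fun _ ha => ⟨not_not_intro ha.1, ha.2⟩ }⟩
  left_inv I := Subtype.ext (compl_compl (I : Set E))
  right_inv J := Subtype.ext (compl_compl (J : Set Eᵒᵈ))

lemma removable_dual_iff {a : E} {I : Set E} :
    Removable (OrderDual.toDual a) (OrderDual.ofDual ⁻¹' Iᶜ) ↔ Addable a I := by
  refine and_congr Iff.rfl ?_
  rw [← isUpperSet_compl (s := I ∪ {a}), ← isLowerSet_preimage_ofDual_iff, compl_union]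
  rfl

lemma addable_dual_iff {a : E} {I : Set E} :
    Addable (OrderDual.toDual a) (OrderDual.ofDual ⁻¹' Iᶜ) ↔ Removable a I := by
  refine and_congr not_not ?_
  rw [← isUpperSet_compl (s := I \ {a}), ← isLowerSet_preimage_ofDual_iff, sdiff_eq,
    compl_inter, compl_compl]
  rfl

/-- The operator tries removal first, and duality turns removal into addition, so the priorities are
reversed. This is harmless because a proper ideal never admits both for the same label. -/
lemma IsFullOver.opS_dual (h : IsFullOver A ε) {I : Set E} (hI : IsProperIdeal ε I) (i : P) :
    opS (dualLabel ε) i (OrderDual.ofDual ⁻¹' Iᶜ) = OrderDual.ofDual ⁻¹' (opS ε i I)ᶜ := by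
  have hch : ∀ a b : Eᵒᵈ, dualLabel ε a = dualLabel ε b → a ≤ b ∨ b ≤ a :=
    fun a b hab => (h.chain _ _ hab).symm
  by_cases h1 : ∃ a, ε a = i ∧ Removable a I
  · obtain ⟨a, rfl, ha⟩ := h1
    rw [opS_of_removable h.chain ha]
    refine (opS_of_addable hch (addable_dual_iff.2 ha) ?_).trans ?_
    · rintro ⟨b, hb, hb'⟩
      exact h.not_addable_of_removable hI ha ⟨b.ofDual, hb, removable_dual_iff.1 hb'⟩
    · rw [sdiff_eq, compl_inter, compl_compl]
      rfl
  by_cases h2 : ∃ a, ε a = i ∧ Addable a I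
  · obtain ⟨a, rfl, ha⟩ := h2
    rw [opS_of_addable h.chain ha h1]
    refine (opS_of_removable hch (removable_dual_iff.2 ha)).trans ?_
    rw [compl_union]
    rfl
  · rw [opS_of_not h1 h2]
    refine opS_of_not ?_ ?_
    · rintro ⟨b, hb, hb'⟩
      exact h2 ⟨b.ofDual, hb, removable_dual_iff.1 hb'⟩
    · rintro ⟨b, hb, hb'⟩
      exact h1 ⟨b.ofDual, hb, addable_dual_iff.1 hb'⟩

end Action

end FullHeap

theorem proposition3p4 {P : Type u} {E : Type v} [Fintype P] [PartialOrder E]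
    (A : Matrix P P ℤ) (hA : FullHeap.IsDoublyLacedGCM A)
    (ε : E → P) (hE : FullHeap.IsSimplyFoldedFull A ε) :
    ∃ (_ : MulAction (FullHeap.WeylGroup A) (FullHeap.ProperIdeal ε))
      (_ : MulAction (FullHeap.WeylGroup A) (FullHeap.ProperIdeal (FullHeap.dualLabel ε))),
      -- the generators act on the proper ideals of `E` and of `E*` by the operators `S_i`
      (∀ (i : P) (I : FullHeap.ProperIdeal ε),
        ((FullHeap.simpleReflection A i • I : FullHeap.ProperIdeal ε) : Set E) =
          FullHeap.opS ε i (I : Set E)) ∧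
      (∀ (i : P) (J : FullHeap.ProperIdeal (FullHeap.dualLabel ε)),
        ((FullHeap.simpleReflection A i • J : FullHeap.ProperIdeal (FullHeap.dualLabel ε)) :
            Set Eᵒᵈ) =
          FullHeap.opS (FullHeap.dualLabel ε) i (J : Set Eᵒᵈ)) ∧
      -- the action on the proper ideals of `E` is transitive: there is exactly one orbit
      Nonempty (FullHeap.ProperIdeal ε) ∧
      MulAction.IsPretransitive (FullHeap.WeylGroup A) (FullHeap.ProperIdeal ε) ∧
      -- `I ↦ *(E ∖ I)` is an isomorphism of `W`-sets
      ∃ φ : FullHeap.ProperIdeal ε ≃ FullHeap.ProperIdeal (FullHeap.dualLabel ε),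
        (∀ I : FullHeap.ProperIdeal ε,
          (φ I : Set Eᵒᵈ) = OrderDual.toDual '' (I : Set E)ᶜ) ∧
        ∀ (w : FullHeap.WeylGroup A) (I : FullHeap.ProperIdeal ε), φ (w • I) = w • φ I := by
  have h := hE.isFullOver hA
  let φ := FullHeap.complEquiv ε
  -- The action on the dual side is transported along `φ`, which makes equivariance automatic; that
  -- its generators act by the dual operators is `IsFullOver.opS_dual`.
  refine ⟨MulAction.compHom _ h.weylHom,
    MulAction.compHom _ ((φ.permCongrHom.toMonoidHom).comp h.weylHom), ?_, ?_, ?_, ?_, φ, ?_, ?_⟩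
  · intro i I
    exact congrArg Subtype.val (h.weylHom_simpleReflection i I)
  · intro i J
    obtain ⟨I, rfl⟩ := φ.surjective J
    have e : φ (h.weylHom (FullHeap.simpleReflection A i) (φ.symm (φ I))) = φ (h.op i I) := by
      rw [φ.symm_apply_apply, h.weylHom_simpleReflection]
    exact (congrArg Subtype.val e).trans (h.opS_dual I.2 i).symm
  · obtain ⟨p⟩ := h.nonempty
    obtain ⟨a, -⟩ := h.exists_label p
    exact ⟨⟨Set.Iic a, h.isProperIdeal_Iic a⟩⟩
  · let := MulAction.compHom (FullHeap.ProperIdeal ε) h.weylHom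
    exact ⟨h.exists_weylHom⟩
  · intro I
    exact (OrderDual.toDual.image_eq_preimage_symm _).symm
  · intro w I
    change φ (h.weylHom w I) = φ (h.weylHom w (φ.symm (φ I)))
    rw [φ.symm_apply_apply]
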